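/- **Setting.** Let $\mathcal U$ be a smooth $n$-dimensional manifold (Hausdorff, second countable) with a smooth Lorentzian metric $g$ of signature $(-,+,\dots,+)$. Let $\Phi:\mathcal U\to\mathbb R$ be smooth with $d\Phi\neq0$ on $\mathcal M:=\Phi^{-1}(0)$, so that $\mathcal M$ is a smooth embedded hypersurface, and let $g^{\mathcal M}$ be the bilinear form induced by $g$ on $\mathcal M$. Assume the following. 1. $g^{\mathcal M}$ has constant corank $k\ge1$, and its kernel, the null distribution $\mathcal N\subset T\mathcal M$, is involutive. Let $\mathcal S\subset T\mathcal M$ be a smooth subbundle with $T\mathcal M=\mathcal N\oplus\mathcal S$. 2. $\mathcal V$ is a $C^2$ vector field on $\mathcal M$ (the intrinsic evolution is $\dot X=\mathcal V(X)$) with $[\mathcal V,W]\in\Gamma(\mathcal N)$ for every smooth $W\in\Gamma(\mathcal N)$. Write $\mathcal V=\mathcal V_{\mathcal N}+\mathcal V_{\mathcal S}$ for its decomposition. 3. $\Psi:\mathcal M\to\mathbb R$ is $C^1$ and bounded below, $d\Psi$ vanishes on $\mathcal N$, and for some $c>0$ one has $d\Psi(\mathcal V_{\mathcal S})\le -c\,g^{\mathcal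 M}(\mathcal V_{\mathcal S},\mathcal V_{\mathcal S})$ on $\mathcal M$. 4. The leaves of the foliation $\mathscr F$ generated by $\mathcal N$ are compact. The leaf space $\mathcal M_{\mathrm{red}}=\mathcal M/\mathscr F$, with the quotient topology, is Hausdorff and carries the smooth structure of dimension $n-1-k$ for which the projection $\pi:\mathcal M\to\mathcal M_{\mathrm{red}}$ (whose fibres are the leaves) is a smooth submersion. 5. $g_{\mathrm{red}}$ is the smooth Riemannian metric on $\mathcal M_{\mathrm{red}}$ induced by $g^{\mathcal M}$, that is, $g_{\mathrm{red}}(D\pi_X U,D\pi_X V)=g^{\mathcal M}(U,V)$ for all $X\in\mathcal M$ and $U,V\in T_X\mathcal M$, and $(\mathcal M_{\mathrm{red}},g_{\mathrm{red}})$ is complete. A subset of $\mathcal M$ is called bounded if it has finite diameter for the pseudo-distance of $g^{\mathcal M}$, i.e. the infimum of the lengths $\int\sqrt{g^{\mathcal M}(\dot\gamma,\dot\gamma)}\,ds$ of the $C^1$ paths $\gamma$ in $\mathcal M$ joining two points. **Claim.** Let $X:[0,\infty)\to\mathcal M$ be a solution of $\dot X=\mathcal V(X)$ with bounded image. Then its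 $\omega$-limit set $\{Y\in\mathcal M: X(t_k)\to Y\text{ for some }t_k\to\infty\}$ is nonempty and relatively compact in $\mathcal M$; moreover, for every sequence $t_k\to\infty$, the sequence $X(t_k)$ has a subsequence that converges in $\mathcal M$. -/

import Mathlib

open Set Filter Topology Manifold
open scoped Manifold ContDiff NNReal ENNReal

noncomputable section

namespace NullReduction

section General

variable {E : Type*} [NormedAddCommGroup E] [NormedSpace ℝ E]
  {H : Type*} [TopologicalSpace H] (I : ModelWithCorners ℝ E H)
  {M : Type*} [TopologicalSpace M] [ChartedSpace H M]

/-- `W` is a vector field of class `C^r` on `M`. -/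
def IsVectorField [IsManifold I 1 M] (r : ℕ∞ω) (W : Π x : M, TangentSpace I x) : Prop :=
  ContMDiff I I.tangent r (fun x ↦ (⟨x, W x⟩ : TangentBundle I M))

/-- `D` is a smooth distribution of rank `r`: each `D x` is an `r`-dimensional subspace of the
tangent space, and locally `D` is spanned by `r` smooth vector fields. -/
def IsSmoothDistribution [IsManifold I 1 M] (r : ℕ)
    (D : Π x : M, Submodule ℝ (TangentSpace I x)) : Prop :=
  (∀ x, Module.finrank ℝ (D x) = r) ∧
  ∀ x₀ : M, ∃ O : Set M, IsOpen O ∧ x₀ ∈ O ∧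
    ∃ W : Fin r → Π x : M, TangentSpace I x,
      (∀ i, ContMDiffOn I I.tangent ∞ (fun x ↦ (⟨x, W i x⟩ : TangentBundle I M)) O) ∧
      ∀ x ∈ O, Submodule.span ℝ (range fun i ↦ W i x) = D x

/-- `D` is involutive: the Lie bracket of two smooth sections of `D` is a section of `D`. -/
def IsInvolutive [IsManifold I 1 M] (D : Π x : M, Submodule ℝ (TangentSpace I x)) : Prop :=
  ∀ W₁ W₂ : Π x : M, TangentSpace I x,
    IsVectorField I ∞ W₁ → IsVectorField I ∞ W₂ →
    (∀ x, W₁ x ∈ D x) → (∀ x, W₂ x ∈ D x) →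
    ∀ x, VectorField.mlieBracket I W₁ W₂ x ∈ D x

/-- The vector field `V` preserves the distribution `D`: for every smooth section `W` of `D`, the
Lie bracket `[V, W]` is a section of `D`. -/
def Preserves [IsManifold I 1 M] (V : Π x : M, TangentSpace I x)
    (D : Π x : M, Submodule ℝ (TangentSpace I x)) : Prop :=
  ∀ W : Π x : M, TangentSpace I x, IsVectorField I ∞ W → (∀ x, W x ∈ D x) →
    ∀ x, VectorField.mlieBracket I V W x ∈ D x

/-- `x` and `y` are the endpoints of a `C^1` path that is everywhere tangent to `D`. -/
def JoinedAlong (D : Π x : M, Submodule ℝ (TangentSpace I x)) (x y : M) : Prop :=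
  ∃ γ : ℝ → M, γ 0 = x ∧ γ 1 = y ∧ ContMDiffOn 𝓘(ℝ, ℝ) I 1 γ (Icc 0 1) ∧
    ∀ t ∈ Icc (0 : ℝ) 1, mfderivWithin 𝓘(ℝ, ℝ) I γ (Icc 0 1) t (1 : ℝ) ∈ D (γ t)

/-- The leaf relation of `D`: two points are related when they can be joined by a finite
concatenation of `C^1` paths tangent to `D`. For an involutive smooth distribution of constant rank
the classes are the leaves (maximal connected integral manifolds) of the foliation it generates. -/
def leafSetoid (D : Π x : M, Submodule ℝ (TangentSpace I x)) : Setoid M :=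
  Relation.EqvGen.setoid (JoinedAlong I D)

/-- The leaf through `x`. -/
def leaf (D : Π x : M, Submodule ℝ (TangentSpace I x)) (x : M) : Set M :=
  {y | leafSetoid I D x y}

/-- The leaf space `M / F`, with the quotient topology. -/
abbrev LeafSpace (D : Π x : M, Submodule ℝ (TangentSpace I x)) : Type _ :=
  Quotient (leafSetoid I D)

/-- The canonical projection onto the leaf space; its fibres are the leaves. -/
def leafProj (D : Π x : M, Submodule ℝ (TangentSpace I x)) : M → LeafSpace I D :=
  Quotient.mk (leafSetoid I D)

/-- The differential `dΨ` of a real function, as a linear form on each tangent space. -/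
def differential (Ψ : M → ℝ) (x : M) : TangentSpace I x →L[ℝ] ℝ :=
  mfderiv I 𝓘(ℝ, ℝ) Ψ x

/-- The (pseudo-)distance of a field `b` of positive semidefinite bilinear forms: the infimum of
the lengths `∫ √(b(γ', γ'))` of the `C^1` paths between two points (`∞` if there is no path). -/
def formEDist (b : Π x : M, TangentSpace I x →L[ℝ] TangentSpace I x →L[ℝ] ℝ) (x y : M) : ℝ≥0∞ :=
  letI : ∀ z : M, ENorm (TangentSpace I z) := fun z ↦ ⟨fun v ↦ ENNReal.ofReal (√(b z v v))⟩
  riemannianEDist I x y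

/-- `B` has finite diameter for the (pseudo-)distance of `b`. -/
def IsBoundedFor (b : Π x : M, TangentSpace I x →L[ℝ] TangentSpace I x →L[ℝ] ℝ)
    (B : Set M) : Prop :=
  ∃ R : ℝ≥0, ∀ x ∈ B, ∀ y ∈ B, formEDist I b x y ≤ R

/-- `M` is complete for the distance of `b`: every Cauchy sequence converges in `M`. -/
def IsCompleteFor (b : Π x : M, TangentSpace I x →L[ℝ] TangentSpace I x →L[ℝ] ℝ) : Prop :=
  ∀ u : ℕ → M,
    (∀ ε : ℝ≥0∞, 0 < ε → ∃ N : ℕ, ∀ p ≥ N, ∀ q ≥ N, formEDist I b (u p) (u q) < ε) →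
    ∃ y : M, Tendsto u atTop (𝓝 y)

end General

/-- The `ω`-limit set of the trajectory `X : [0, ∞) → M`: all limits of `X (t_k)` with
`t_k → ∞`. -/
def omegaLimitSet {M : Type*} [TopologicalSpace M] (X : ℝ → M) : Set M :=
  {y | ∃ t : ℕ → ℝ, Tendsto t atTop atTop ∧ Tendsto (fun k ↦ X (t k)) atTop (𝓝 y)}

/-- A smooth Lorentzian metric of signature `(-, +, …, +)` on an `(m + 1)`-dimensional manifold. -/
structure LorentzianMetric (m : ℕ) (U : Type*) [TopologicalSpace U]
    [ChartedSpace (EuclideanSpace ℝ (Fin (m + 1))) U] [IsManifold (𝓡 (m + 1)) ∞ U] where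
  /-- the bilinear form on each tangent space -/
  form : Π x : U, TangentSpace (𝓡 (m + 1)) x →L[ℝ] TangentSpace (𝓡 (m + 1)) x →L[ℝ] ℝ
  symm : ∀ x v w, form x v w = form x w v
  signature : ∀ x, ∃ e : Module.Basis (Fin (m + 1)) ℝ (TangentSpace (𝓡 (m + 1)) x),
    ∀ i j, form x (e i) (e j) = if i = j then (if i = 0 then -1 else 1) else 0
  smooth : ContMDiff (𝓡 (m + 1))
    ((𝓡 (m + 1)).prod 𝓘(ℝ, EuclideanSpace ℝ (Fin (m + 1)) →L[ℝ]
      EuclideanSpace ℝ (Fin (m + 1)) →L[ℝ] ℝ)) ∞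
    (fun x ↦ Bundle.TotalSpace.mk' (EuclideanSpace ℝ (Fin (m + 1)) →L[ℝ]
      EuclideanSpace ℝ (Fin (m + 1)) →L[ℝ] ℝ)
      (E := fun y : U ↦ TangentSpace (𝓡 (m + 1)) y →L[ℝ] TangentSpace (𝓡 (m + 1)) y →L[ℝ] ℝ)
      x (form x))

section Constraint

variable {m : ℕ} {U : Type*} [TopologicalSpace U]
  [ChartedSpace (EuclideanSpace ℝ (Fin (m + 1))) U]

/-- The constraint set `Φ⁻¹(0)`, with the subspace topology. -/
abbrev ConstraintSet (Φ : U → ℝ) : Type _ := {x : U // Φ x = 0}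

variable [IsManifold (𝓡 (m + 1)) ∞ U] {Φ : U → ℝ}
  [ChartedSpace (EuclideanSpace ℝ (Fin m)) (ConstraintSet Φ)]

/-- The form `g^M` induced on the constraint hypersurface: the pullback of `g` under the
inclusion. -/
def inducedForm (g : LorentzianMetric m U) (x : ConstraintSet Φ) :
    TangentSpace (𝓡 m) x →L[ℝ] TangentSpace (𝓡 m) x →L[ℝ] ℝ :=
  ((mfderiv (𝓡 m) (𝓡 (m + 1)) (Subtype.val : ConstraintSet Φ → U) x).precomp ℝ).comp
    ((g.form x.1).comp (mfderiv (𝓡 m) (𝓡 (m + 1)) (Subtype.val : ConstraintSet Φ → U) x))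

theorem inducedForm_apply (g : LorentzianMetric m U) (x : ConstraintSet Φ)
    (v w : TangentSpace (𝓡 m) x) :
    inducedForm g x v w = g.form x.1
      (mfderiv (𝓡 m) (𝓡 (m + 1)) (Subtype.val : ConstraintSet Φ → U) x v)
      (mfderiv (𝓡 m) (𝓡 (m + 1)) (Subtype.val : ConstraintSet Φ → U) x w) :=
  rfl

/-- The null distribution: the pointwise kernel of the induced form. -/
def nullDistribution (g : LorentzianMetric m U) (x : ConstraintSet Φ) :
    Submodule ℝ (TangentSpace (𝓡 m) x) where
  carrier := {v | ∀ w, inducedForm g x v w = 0}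
  add_mem' {a b} ha hb w := by simp [ha w, hb w]
  zero_mem' w := by simp
  smul_mem' c a ha w := by simp [ha w]

end Constraint

end NullReduction

end

/-! Compactness is found in the leaf space and pulled back. The leaf projection carries `g^M` to
`g_red`, so it does not increase lengths of paths, and a bounded trajectory has a bounded image
downstairs (`formEDist_map_le`). There `g_red` is a complete Riemannian metric, so Hopf–Rinow puts
the image in a compact set `K` (`exists_isCompact_superset_of_isBoundedFor`).

The projection is moreover proper: it is open, being a submersion, and its fibres are the leaves,
which are compact and connected (`IsOpenMap.isCompact_preimage_of_isPreconnected_fibers`). The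
trajectory thus stays in the compact preimage of `K`, and sequential compactness finishes the proof.
-/

/-- **Hopf–Rinow–Cohn-Vossen**: in a complete, locally compact extended metric space in which
points at distance `< a + b` admit almost intermediate points, closed balls are compact. -/
theorem isCompact_closedEBall_of_approx_between {X : Type*} [EMetricSpace X] [CompleteSpace X]
    [WeaklyLocallyCompactSpace X]
    (hX : ∀ (x y : X) (a b : ℝ≥0), edist x y < a + b → ∃ z, edist x z ≤ a ∧ edist z y ≤ b)
    (p : X) (r : ℝ≥0) : IsCompact (Metric.closedEBall p (r : ℝ≥0∞)) := by
  set S : Set ℝ≥0 := {r | IsCompact (Metric.closedEBall p (r : ℝ≥0∞))} with hS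
  have hdown : ∀ {r s : ℝ≥0}, r ≤ s → s ∈ S → r ∈ S := fun hrs hs ↦
    IsCompact.of_isClosed_subset hs Metric.isClosed_closedEBall
      (Metric.closedEBall_subset_closedEBall (by exact_mod_cast hrs))
  have hzero : (0 : ℝ≥0) ∈ S := by simp [hS]
  -- Good radii are closed under increasing limits: a point of the `R`-ball lies within `η` of the
  -- ball of radius `R - η / 2`, so an `ε / 2`-net of the latter is an `ε`-net of the former. Only
  -- half of `η` is removed because `hX` needs a strict inequality.
  have hlim : ∀ R : ℝ≥0, 0 < R → (∀ r < R, r ∈ S) → R ∈ S := by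
    intro R hR h
    refine isCompact_iff_totallyBounded_isComplete.2
      ⟨EMetric.totallyBounded_iff.2 fun ε hε ↦ ?_, Metric.isClosed_closedEBall.isComplete⟩
    obtain ⟨η, hη, hηε⟩ := ENNReal.lt_iff_exists_nnreal_btwn.1 (ENNReal.half_pos hε.ne')
    have hη' : 0 < η := by exact_mod_cast hη
    have hr : R - η / 2 < R := tsub_lt_self hR (by positivity)
    obtain ⟨t, ht, hcov⟩ := EMetric.totallyBounded_iff.1 (h _ hr).totallyBounded
      (ε / 2) (ENNReal.half_pos hε.ne')
    refine ⟨t, ht, fun x hx ↦ ?_⟩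
    have hlt : edist p x < ((R - η / 2 : ℝ≥0) : ℝ≥0∞) + (η : ℝ≥0∞) := by
      rw [Metric.mem_closedEBall, edist_comm] at hx
      refine hx.trans_lt ?_
      have : R < R - η / 2 + η := by
        have h1 : R ≤ R - η / 2 + η / 2 := le_tsub_add
        have h2 : η / 2 < η := by
          rw [← NNReal.coe_lt_coe]; push_cast; have : (0 : ℝ) < η := hη'; linarith
        exact h1.trans_lt (by gcongr)
      exact_mod_cast this
    obtain ⟨z, hz, hzx⟩ := hX p x _ _ hlt
    obtain ⟨y, hy, hzy⟩ := mem_iUnion₂.1 (hcov (by rwa [Metric.mem_closedEBall, edist_comm]))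
    refine mem_iUnion₂.2 ⟨y, hy, ?_⟩
    calc edist x y ≤ edist z x + edist z y := by rw [edist_comm z x]; exact edist_triangle _ _ _
      _ < ε / 2 + ε / 2 := ENNReal.add_lt_add (hzx.trans_lt hηε) hzy
      _ = ε := ENNReal.add_halves ε
  -- Good radii can be increased: some thickening of the compact ball lies in a compact set, by
  -- local compactness, and a slightly larger ball lies in that thickening.
  have hstep : ∀ s ∈ S, ∃ s' ∈ S, s < s' := by
    intro s hs
    obtain ⟨K, hK, hsK⟩ := exists_compact_superset hs
    obtain ⟨δ, hδ, hδK⟩ := IsCompact.exists_cthickening_subset_open hs isOpen_interior hsK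
    lift δ to ℝ≥0 using hδ.le
    have hδ' : 0 < δ := by exact_mod_cast hδ
    refine ⟨s + δ / 2, ?_, lt_add_of_pos_right _ (by positivity)⟩
    refine hK.of_isClosed_subset Metric.isClosed_closedEBall
      (Subset.trans (fun x hx ↦ ?_) (hδK.trans interior_subset))
    have hlt : edist p x < (s : ℝ≥0∞) + (δ : ℝ≥0∞) := by
      rw [Metric.mem_closedEBall, edist_comm] at hx
      refine hx.trans_lt ?_
      have : s + δ / 2 < s + δ := by
        have h2 : δ / 2 < δ := by
          rw [← NNReal.coe_lt_coe]; push_cast; have : (0 : ℝ) < δ := hδ'; linarith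
        gcongr
      exact_mod_cast this
    obtain ⟨z, hz, hzx⟩ := hX p x _ _ hlt
    refine Metric.mem_cthickening_of_edist_le x z _ _
      (by rwa [Metric.mem_closedEBall, edist_comm]) ?_
    rw [edist_comm]; simpa using hzx
  by_contra hr
  have hbdd : BddAbove S := ⟨r, fun s hs ↦ le_of_not_ge fun hrs ↦ hr (hdown hrs hs)⟩
  have hsup : sSup S ∈ S := by
    rcases eq_zero_or_pos (sSup S) with h0 | hpos
    · rwa [h0]
    · refine hlim _ hpos fun r hr ↦ ?_
      obtain ⟨s, hs, hrs⟩ := exists_lt_of_lt_csSup ⟨0, hzero⟩ hr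
      exact hdown hrs.le hs
  obtain ⟨s', hs', hlt⟩ := hstep _ hsup
  exact (le_csSup hbdd hs').not_gt hlt

/-! ### Properness and openness of projections -/

/-- An open continuous surjection with compact connected fibres, from a locally compact Hausdorff
space to a Hausdorff space, has compact preimages of compact sets. -/
theorem IsOpenMap.isCompact_preimage_of_isPreconnected_fibers {X Y : Type*}
    [TopologicalSpace X] [TopologicalSpace Y] [T2Space X] [LocallyCompactSpace X] [T2Space Y]
    {f : X → Y} (hopen : IsOpenMap f) (hf : Continuous f) (hsurj : Function.Surjective f)
    (hcompact : ∀ y, IsCompact (f ⁻¹' {y})) (hconn : ∀ y, IsPreconnected (f ⁻¹' {y}))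
    {K : Set Y} (hK : IsCompact K) : IsCompact (f ⁻¹' K) := by
  suffices h : ∃ C, IsCompact C ∧ f ⁻¹' K ⊆ C by
    obtain ⟨C, hC, hKC⟩ := h
    exact hC.of_isClosed_subset (hK.isClosed.preimage hf) hKC
  refine hK.induction_on (p := fun s ↦ ∃ C, IsCompact C ∧ f ⁻¹' s ⊆ C) ⟨∅, by simp⟩ ?_ ?_ ?_
  · rintro s t hst ⟨C, hC, h⟩
    exact ⟨C, hC, (preimage_mono hst).trans h⟩
  · rintro s t ⟨C, hC, h⟩ ⟨C', hC', h'⟩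
    exact ⟨C ∪ C', hC.union hC', by rw [preimage_union]; exact union_subset_union h h'⟩
  · intro q _
    obtain ⟨W, hW, hqW, hWc⟩ := exists_isOpen_superset_and_isCompact_closure (hcompact q)
    obtain ⟨x, rfl⟩ := hsurj q
    have hfr : IsCompact (f '' frontier W) :=
      (hWc.of_isClosed_subset isClosed_frontier frontier_subset_closure).image hf
    have hnot : f x ∉ f '' frontier W := by
      rintro ⟨z, hz, hzx⟩
      rw [hW.frontier_eq] at hz
      exact hz.2 (hqW hzx)
    -- A fibre over this neighbourhood meets `W` but not its frontier; being connected, it lies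
    -- inside `W`.
    refine ⟨f '' W ∩ (f '' frontier W)ᶜ, mem_nhdsWithin_of_mem_nhds (inter_mem ?_ ?_),
      closure W, hWc, ?_⟩
    · exact hopen.image_mem_nhds (hW.mem_nhds (hqW rfl))
    · exact hfr.isClosed.isOpen_compl.mem_nhds hnot
    · rintro y ⟨⟨w, hw, hwy⟩, hy⟩
      have hsub : f ⁻¹' {f y} ⊆ W := by
        refine (hconn (f y)).subset_left_of_subset_union hW isClosed_closure.isOpen_compl
          (disjoint_compl_right.mono_left subset_closure) (fun z hz ↦ ?_) ⟨w, hwy, hw⟩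
        by_cases hzW : z ∈ closure W
        · refine Or.inl (by_contra fun hz' ↦ hy ?_)
          exact ⟨z, by rw [hW.frontier_eq]; exact ⟨hzW, hz'⟩, hz⟩
        · exact Or.inr hzW
      exact subset_closure (hsub rfl)

/-- A submersion onto a boundaryless manifold from a boundaryless manifold is open. -/
theorem Manifold.IsSubmersion.isOpenMap {E E' H H' M N : Type*}
    [NormedAddCommGroup E] [NormedSpace ℝ E] [NormedAddCommGroup E'] [NormedSpace ℝ E']
    [TopologicalSpace H] [TopologicalSpace H'] {I : ModelWithCorners ℝ E H}
    {J : ModelWithCorners ℝ E' H'} [I.Boundaryless] [J.Boundaryless]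
    [TopologicalSpace M] [ChartedSpace H M] [TopologicalSpace N] [ChartedSpace H' N]
    {n : ℕ∞ω} {f : M → N} (hf : IsSubmersion I J n f) : IsOpenMap f := by
  obtain ⟨F, _, _, hf⟩ := hf
  refine IsOpenMap.of_nhds_le fun x ↦ ?_
  have h := hf x
  set φ := h.domChart
  set ψ := h.codChart
  have hx : x ∈ φ.source := h.mem_domChart_source
  have hfx : f x ∈ ψ.source := h.mem_codChart_source
  have hφ : map (φ.extend I) (𝓝 x) = 𝓝 (φ.extend I x) :=
    φ.map_extend_nhds_of_boundaryless hx
  -- In adapted charts the map is a linear projection, which is open; the rest transports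
  -- neighbourhood filters through the charts.
  have hloc : (ψ.extend J) ∘ f =ᶠ[𝓝 x] (Prod.fst ∘ h.equiv) ∘ φ.extend I := by
    filter_upwards [φ.open_source.mem_nhds hx] with y hy
    have hy' : y ∈ (φ.extend I).source := by rwa [φ.extend_source]
    have := h.writtenInCharts ((φ.extend I).map_source hy')
    simp only [Function.comp_apply] at this ⊢
    rwa [(φ.extend I).left_inv hy'] at this
  have hmap : map ((ψ.extend J) ∘ f) (𝓝 x) = 𝓝 (ψ.extend J (f x)) := by
    rw [map_congr hloc, ← Filter.map_map, hφ]
    have h1 : IsOpenMap (Prod.fst ∘ h.equiv) := isOpenMap_fst.comp h.equiv.toHomeomorph.isOpenMap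
    have h2 : Continuous (Prod.fst ∘ h.equiv) := continuous_fst.comp h.equiv.continuous
    have h3 := h1.map_nhds_eq h2.continuousAt (x := φ.extend I x)
    rw [h3]; exact congrArg 𝓝 (hloc.self_of_nhds.symm)
  have hcont : map (ψ.extend J).symm (𝓝 (ψ.extend J (f x))) = 𝓝 (f x) := by
    have h4 : map (ψ.extend J) (𝓝 (f x)) = 𝓝 (ψ.extend J (f x)) :=
      ψ.map_extend_nhds_of_boundaryless hfx
    rw [← h4, Filter.map_map]
    have : (ψ.extend J).symm ∘ (ψ.extend J) =ᶠ[𝓝 (f x)] id := by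
      filter_upwards [ψ.open_source.mem_nhds hfx] with y hy
      exact (ψ.extend J).left_inv (by rwa [ψ.extend_source])
    rw [map_congr this, map_id]
  rw [← hcont, ← hmap, Filter.map_map]
  refine (map_congr ?_).ge
  filter_upwards [φ.open_source.mem_nhds hx] with y hy
  exact ((ψ.extend J).left_inv
    (by rw [ψ.extend_source]; exact h.source_subset_preimage_source hy)).symm

/-! ### Almost intermediate points -/

section Riemannian

open Bundle

/-- In a Riemannian manifold, points at distance `< a + b` admit an almost intermediate point. -/
theorem IsRiemannianManifold.exists_edist_le_edist_le {E H M : Type*}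
    [NormedAddCommGroup E] [NormedSpace ℝ E] [TopologicalSpace H] (I : ModelWithCorners ℝ E H)
    [EMetricSpace M] [ChartedSpace H M] [RiemannianBundle (fun x : M ↦ TangentSpace I x)]
    [IsRiemannianManifold I M] {x y : M} {a b : ℝ≥0}
    (h : edist x y < a + b) : ∃ z, edist x z ≤ a ∧ edist z y ≤ b := by
  rcases le_total (edist x y) a with hxy | hxy
  · exact ⟨y, hxy, by simp⟩
  rw [IsRiemannianManifold.out (I := I)] at h
  obtain ⟨γ, hγ0, hγ1, hγ, hlen⟩ := exists_lt_of_riemannianEDist_lt h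
  have hcont : ContinuousOn (fun t ↦ edist x (γ t)) (Icc 0 1) :=
    (continuous_const.edist continuous_id).comp_continuousOn hγ.continuousOn
  -- On a path shorter than `a + b`, stop at distance exactly `a` from `x`: the first piece has
  -- length at least `a`, so the second has length less than `b`.
  obtain ⟨t, ht, hta⟩ := intermediate_value_Icc zero_le_one hcont
    (show (a : ℝ≥0∞) ∈ Icc (edist x (γ 0)) (edist x (γ 1)) by rw [hγ0, hγ1]; simpa using hxy)
  refine ⟨γ t, hta.le, ?_⟩
  have h1 : (a : ℝ≥0∞) ≤ pathELength I γ 0 t := by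
    rw [← hta]; dsimp only; rw [IsRiemannianManifold.out (I := I)]
    exact riemannianEDist_le_pathELength (hγ.mono (Icc_subset_Icc_right ht.2)) hγ0 rfl ht.1
  have h2 : edist (γ t) y ≤ pathELength I γ t 1 := by
    rw [IsRiemannianManifold.out (I := I)]
    exact riemannianEDist_le_pathELength (hγ.mono (Icc_subset_Icc_left ht.1)) rfl hγ1 ht.2
  rw [← pathELength_add ht.1 ht.2] at hlen
  by_contra! hb
  exact hlen.not_ge (add_le_add h1 (hb.le.trans h2))

end Riemannian

namespace NullReduction

/-! ### Pseudo-distances and leaves -/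

section

variable {E E' H H' M N : Type*}
  [NormedAddCommGroup E] [NormedSpace ℝ E] [TopologicalSpace H] {I : ModelWithCorners ℝ E H}
  [NormedAddCommGroup E'] [NormedSpace ℝ E'] [TopologicalSpace H'] {J : ModelWithCorners ℝ E' H'}
  [TopologicalSpace M] [ChartedSpace H M] [TopologicalSpace N] [ChartedSpace H' N]

/-- A `C^1` map that does not increase the quadratic forms does not increase the distances. -/
theorem formEDist_map_le {f : M → N} (hf : ContMDiff I J 1 f)
    {b : Π x : M, TangentSpace I x →L[ℝ] TangentSpace I x →L[ℝ] ℝ}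
    {b' : Π y : N, TangentSpace J y →L[ℝ] TangentSpace J y →L[ℝ] ℝ}
    (h : ∀ x v, b' (f x) (mfderiv I J f x v) (mfderiv I J f x v) ≤ b x v v) (x y : M) :
    formEDist J b' (f x) (f y) ≤ formEDist I b x y := by
  simp only [formEDist, riemannianEDist_def]
  refine le_iInf₂ fun γ hγ ↦ ?_
  -- The image of each path competes in the infimum downstairs, with a pointwise smaller integrand.
  refine (iInf₂_le (γ.map hf.continuous) (hf.comp hγ)).trans (MeasureTheory.lintegral_mono fun t ↦ ?_)
  have hd : mfderiv (𝓡∂ 1) J (γ.map hf.continuous) t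
      = (mfderiv I J f (γ t)).comp (mfderiv (𝓡∂ 1) I γ t) :=
    mfderiv_comp t ((hf.mdifferentiable one_ne_zero) _) ((hγ.mdifferentiable one_ne_zero) _)
  rw [hd]
  exact ENNReal.ofReal_le_ofReal (Real.sqrt_le_sqrt (h (γ t) _))

variable {D : Π x : M, Submodule ℝ (TangentSpace I x)}

/-- An initial piece of a path tangent to `D` is tangent to `D`. -/
theorem joinedAlong_of_mem_Icc {γ : ℝ → M} (hγ : ContMDiffOn 𝓘(ℝ, ℝ) I 1 γ (Icc 0 1))
    (hD : ∀ t ∈ Icc (0 : ℝ) 1, mfderivWithin 𝓘(ℝ, ℝ) I γ (Icc 0 1) t (1 : ℝ) ∈ D (γ t))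
    {t : ℝ} (ht : t ∈ Icc (0 : ℝ) 1) : JoinedAlong I D (γ 0) (γ t) := by
  have hmaps : MapsTo (fun s ↦ t * s) (Icc (0 : ℝ) 1) (Icc 0 1) := fun s hs ↦
    ⟨mul_nonneg ht.1 hs.1, mul_le_one₀ ht.2 hs.1 hs.2⟩
  have hlin : ContMDiff 𝓘(ℝ, ℝ) 𝓘(ℝ, ℝ) 1 (fun s : ℝ ↦ t * s) :=
    (contDiff_const.mul contDiff_id).contMDiff
  refine ⟨γ ∘ fun s ↦ t * s, by simp, by simp, hγ.comp hlin.contMDiffOn hmaps, fun s hs ↦ ?_⟩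
  have huniq : UniqueMDiffWithinAt 𝓘(ℝ, ℝ) (Icc (0 : ℝ) 1) s :=
    (uniqueDiffOn_Icc zero_lt_one s hs).uniqueMDiffWithinAt
  rw [mfderivWithin_comp s ((hγ.mdifferentiableOn one_ne_zero) _ (hmaps hs))
    ((hlin.mdifferentiable one_ne_zero) s).mdifferentiableWithinAt hmaps huniq]
  have hder : mfderivWithin 𝓘(ℝ, ℝ) 𝓘(ℝ, ℝ) (fun s : ℝ ↦ t * s) (Icc 0 1) s (1 : ℝ)
      = t • (1 : ℝ) := by
    rw [mfderivWithin_eq_fderivWithin]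
    have : HasFDerivWithinAt (fun s : ℝ ↦ t * s) (t • ContinuousLinearMap.id ℝ ℝ) (Icc 0 1) s :=
      ((hasFDerivAt_id s).const_mul t).hasFDerivWithinAt
    rw [this.fderivWithin (uniqueDiffOn_Icc zero_lt_one s hs)]
    rfl
  change mfderivWithin 𝓘(ℝ, ℝ) I γ (Icc 0 1) (t * s)
    (mfderivWithin 𝓘(ℝ, ℝ) 𝓘(ℝ, ℝ) (fun s : ℝ ↦ t * s) (Icc 0 1) s (1 : ℝ)) ∈ D (γ (t * s))
  rw [hder]
  erw [map_smul]
  exact (D (γ (t * s))).smul_mem t (hD _ (hmaps hs))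

/-- A path tangent to `D` never leaves the leaf of its starting point. The induction carries a
connected set joining the two points inside the leaf, since the union of such sets, rather than the
mere relation, gives connectedness. -/
theorem isPreconnected_leaf (x : M) : IsPreconnected (leaf I D x) := by
  suffices h : ∀ y z, Relation.EqvGen (JoinedAlong I D) y z →
      ∃ C : Set M, IsPreconnected C ∧ y ∈ C ∧ z ∈ C ∧
        ∀ w ∈ C, Relation.EqvGen (JoinedAlong I D) y w by
    refine isPreconnected_of_forall x fun y hy ↦ ?_
    obtain ⟨C, hC, hx, hy, hsub⟩ := h x y hy
    exact ⟨C, hsub, hx, hy, hC⟩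
  intro y z hyz
  induction hyz with
  | rel y z h =>
    obtain ⟨γ, rfl, rfl, hγ, hD⟩ := h
    refine ⟨γ '' Icc 0 1, isPreconnected_Icc.image _ hγ.continuousOn,
      mem_image_of_mem _ (by simp), mem_image_of_mem _ (by simp), ?_⟩
    rintro _ ⟨t, ht, rfl⟩
    exact .rel _ _ (joinedAlong_of_mem_Icc hγ hD ht)
  | refl y => exact ⟨{y}, isPreconnected_singleton, rfl, rfl, by rintro _ rfl; exact .refl _⟩
  | symm y z h ih =>
    obtain ⟨C, hC, hy, hz, hsub⟩ := ih
    exact ⟨C, hC, hz, hy, fun w hw ↦ .trans _ _ _ (.symm _ _ h) (hsub w hw)⟩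
  | trans y z w h₁ _ ih₁ ih₂ =>
    obtain ⟨C, hC, hy, hz, hsub⟩ := ih₁
    obtain ⟨C', hC', hz', hw, hsub'⟩ := ih₂
    refine ⟨C ∪ C', hC.union z hz hz' hC', Or.inl hy, Or.inr hw, ?_⟩
    rintro v (hv | hv)
    · exact hsub v hv
    · exact .trans _ _ _ h₁ (hsub' v hv)

theorem leafProj_preimage_singleton (x : M) :
    leafProj I D ⁻¹' {leafProj I D x} = leaf I D x := by
  ext y
  exact Quotient.eq.trans ⟨(leafSetoid I D).symm', (leafSetoid I D).symm'⟩

theorem leafProj_surjective : Function.Surjective (leafProj I D) :=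
  Quotient.mk_surjective

end

/-! ### Bounded sets in complete Riemannian manifolds -/

section HopfRinow

open Bundle

/-- **Hopf–Rinow** for a complete Riemannian metric: a set of finite diameter is contained in a
compact set. -/
theorem exists_isCompact_superset_of_isBoundedFor {E H M : Type*}
    [NormedAddCommGroup E] [NormedSpace ℝ E] [FiniteDimensional ℝ E] [TopologicalSpace H]
    {I : ModelWithCorners ℝ E H} [TopologicalSpace M] [ChartedSpace H M] [IsManifold I ∞ M]
    [T2Space M]
    (g : Bundle.ContMDiffRiemannianMetric I ∞ E (fun x : M ↦ TangentSpace I x))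
    (hg : IsCompleteFor I g.inner) {B : Set M} (hB : IsBoundedFor I g.inner B) :
    ∃ K, IsCompact K ∧ B ⊆ K := by
  rcases B.eq_empty_or_nonempty with rfl | ⟨p, hp⟩
  · exact ⟨∅, isCompact_empty, Subset.rfl⟩
  have : LocallyCompactSpace M := Manifold.locallyCompact_of_finiteDimensional I
  let : Bundle.RiemannianBundle (fun x : M ↦ TangentSpace I x) := ⟨g.toRiemannianMetric⟩
  have : IsManifold I 1 M := .of_le (n := ∞) (by simp)
  have : IsContinuousRiemannianBundle E (fun x : M ↦ TangentSpace I x) :=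
    ⟨g.inner, g.contMDiff.continuous, fun _ _ _ ↦ rfl⟩
  let : EMetricSpace M := .ofRiemannianMetric I M
  -- Both distances are infima of lengths over the same paths; the integrands agree because the norm
  -- is the square root of the inner product.
  have hdist : ∀ x y : M, formEDist I g.inner x y = edist x y := by
    intro x y
    change _ = riemannianEDist I x y
    simp only [formEDist, riemannianEDist_def]
    refine iInf_congr fun γ ↦ iInf_congr fun hγ ↦ MeasureTheory.lintegral_congr fun t ↦ ?_
    rw [← ofReal_norm, norm_eq_sqrt_real_inner]
    rfl
  have : CompleteSpace M := by
    refine EMetric.complete_of_cauchySeq_tendsto fun u hu ↦ hg u ?_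
    simp only [hdist]
    exact EMetric.cauchySeq_iff.1 hu
  obtain ⟨R, hR⟩ := hB
  refine ⟨Metric.closedEBall p R, isCompact_closedEBall_of_approx_between
    (fun _ _ _ _ h ↦ IsRiemannianManifold.exists_edist_le_edist_le I h) p R,
    fun x hx ↦ ?_⟩
  rw [Metric.mem_closedEBall, ← hdist]
  exact hR x hx p hp

end HopfRinow

end NullReduction

/-! ### Precompactness of bounded trajectories -/

open NullReduction in
theorem proposition5 {d k : ℕ} (hk : 1 ≤ k)
    -- the ambient Lorentzian phase space
    {U : Type*} [TopologicalSpace U] [T2Space U] [SecondCountableTopology U]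
    [ChartedSpace (EuclideanSpace ℝ (Fin (d + k + 1))) U]
    [IsManifold (𝓡 (d + k + 1)) ∞ U]
    (g : LorentzianMetric (d + k) U)
    -- the constraint hypersurface `M = Φ⁻¹(0)` with its embedded manifold structure
    (Φ : U → ℝ) (hΦ : ContMDiff (𝓡 (d + k + 1)) 𝓘(ℝ, ℝ) ∞ Φ)
    (hreg : ∀ x, Φ x = 0 → differential (𝓡 (d + k + 1)) Φ x ≠ 0)
    [ChartedSpace (EuclideanSpace ℝ (Fin (d + k))) (ConstraintSet Φ)]
    [IsManifold (𝓡 (d + k)) ∞ (ConstraintSet Φ)]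
    (hemb : IsSmoothEmbedding (𝓡 (d + k)) (𝓡 (d + k + 1)) ∞
      (Subtype.val : ConstraintSet Φ → U))
    -- constant corank and involutivity of the null distribution
    (hcorank : ∀ x : ConstraintSet Φ, Module.finrank ℝ (nullDistribution g x) = k)
    (hinv : IsInvolutive (𝓡 (d + k)) (nullDistribution (Φ := Φ) g))
    -- a smooth transversal complement of the null distribution
    (S : Π x : ConstraintSet Φ, Submodule ℝ (TangentSpace (𝓡 (d + k)) x))
    (hS : IsSmoothDistribution (𝓡 (d + k)) d S)
    (hcompl : ∀ x, IsCompl (S x) (nullDistribution g x))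
    -- the intrinsic vector field, which preserves the null foliation
    (V : Π x : ConstraintSet Φ, TangentSpace (𝓡 (d + k)) x)
    (hV : IsVectorField (𝓡 (d + k)) 2 V)
    (hpres : Preserves (𝓡 (d + k)) V (nullDistribution g))
    -- the null-compatible functional with transversal dissipation
    (Ψ : ConstraintSet Φ → ℝ) (hΨ : ContMDiff (𝓡 (d + k)) 𝓘(ℝ, ℝ) 1 Ψ)
    (hΨbdd : BddBelow (Set.range Ψ))
    (hΨnull : ∀ x, ∀ v ∈ nullDistribution g x, differential (𝓡 (d + k)) Ψ x v = 0)
    (hdiss : ∃ c : ℝ, 0 < c ∧ ∀ x, ∀ vS ∈ S x, V x - vS ∈ nullDistribution g x →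
      differential (𝓡 (d + k)) Ψ x vS ≤ -c * inducedForm g x vS vS)
    -- compact leaves and smooth Hausdorff leaf space
    (hleaf : ∀ x, IsCompact (leaf (𝓡 (d + k)) (nullDistribution (Φ := Φ) g) x))
    [T2Space (LeafSpace (𝓡 (d + k)) (nullDistribution (Φ := Φ) g))]
    [ChartedSpace (EuclideanSpace ℝ (Fin d))
      (LeafSpace (𝓡 (d + k)) (nullDistribution (Φ := Φ) g))]
    [IsManifold (𝓡 d) ∞ (LeafSpace (𝓡 (d + k)) (nullDistribution (Φ := Φ) g))]
    (hπ : IsSubmersion (𝓡 (d + k)) (𝓡 d) ∞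
      (leafProj (𝓡 (d + k)) (nullDistribution (Φ := Φ) g)))
    -- the induced Riemannian metric on the leaf space, assumed complete
    (gred : Bundle.ContMDiffRiemannianMetric (𝓡 d) ∞ (EuclideanSpace ℝ (Fin d))
      (fun q : LeafSpace (𝓡 (d + k)) (nullDistribution (Φ := Φ) g) ↦ TangentSpace (𝓡 d) q))
    (hgred : ∀ x : ConstraintSet Φ, ∀ v w : TangentSpace (𝓡 (d + k)) x,
      gred.inner (leafProj (𝓡 (d + k)) (nullDistribution g) x)
        (mfderiv (𝓡 (d + k)) (𝓡 d) (leafProj (𝓡 (d + k)) (nullDistribution (Φ := Φ) g)) x v)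
        (mfderiv (𝓡 (d + k)) (𝓡 d) (leafProj (𝓡 (d + k)) (nullDistribution (Φ := Φ) g)) x w)
      = inducedForm g x v w)
    (hcomplete : IsCompleteFor (𝓡 d) gred.inner)
    -- a bounded trajectory
    (X : ℝ → ConstraintSet Φ) (hX : IsMIntegralCurveOn X V (Set.Ici 0))
    (hbdd : IsBoundedFor (𝓡 (d + k)) (inducedForm g) (X '' Set.Ici 0)) :
    (omegaLimitSet X).Nonempty ∧ IsCompact (closure (omegaLimitSet X)) ∧
      ∀ t : ℕ → ℝ, Tendsto t atTop atTop →
        ∃ φ : ℕ → ℕ, StrictMono φ ∧ ∃ y, Tendsto (fun j ↦ X (t (φ j))) atTop (𝓝 y) := by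
  let π := leafProj (𝓡 (d + k)) (nullDistribution (Φ := Φ) g)
  have hπs : ContMDiff (𝓡 (d + k)) (𝓡 d) ∞ π := by
    obtain ⟨F, _, _, h⟩ := hπ
    exact fun x ↦ (h x).contMDiffAt
  have : LocallyCompactSpace (ConstraintSet Φ) :=
    Manifold.locallyCompact_of_finiteDimensional (𝓡 (d + k))
  have : SecondCountableTopology (ConstraintSet Φ) :=
    IsEmbedding.subtypeVal.secondCountableTopology
  have hbdd' : IsBoundedFor (𝓡 d) gred.inner (π '' (X '' Ici 0)) := by
    obtain ⟨R, hR⟩ := hbdd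
    refine ⟨R, ?_⟩
    rintro _ ⟨x, hx, rfl⟩ _ ⟨y, hy, rfl⟩
    exact (formEDist_map_le (hπs.of_le (by simp)) (fun z v ↦ (hgred z v v).le) x y).trans
      (hR x hx y hy)
  obtain ⟨K, hK, hXK⟩ := exists_isCompact_superset_of_isBoundedFor gred hcomplete hbdd'
  have hC : IsCompact (π ⁻¹' K) := by
    refine hπ.isOpenMap.isCompact_preimage_of_isPreconnected_fibers hπs.continuous
      leafProj_surjective (fun q ↦ ?_) (fun q ↦ ?_) hK
    all_goals obtain ⟨x, rfl⟩ := leafProj_surjective q; rw [leafProj_preimage_singleton]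
    · exact hleaf x
    · exact isPreconnected_leaf x
  have hXC : ∀ t, 0 ≤ t → X t ∈ π ⁻¹' K := fun t ht ↦
    hXK (mem_image_of_mem _ (mem_image_of_mem _ ht))
  have hsub : ∀ t : ℕ → ℝ, Tendsto t atTop atTop →
      ∃ φ : ℕ → ℕ, StrictMono φ ∧ ∃ y, Tendsto (fun j ↦ X (t (φ j))) atTop (𝓝 y) := by
    intro t ht
    -- The trajectory is controlled only for nonnegative times, so finitely many terms are dropped
    -- by the shift `n₀`.
    obtain ⟨n₀, hn₀⟩ := eventually_atTop.1 (ht.eventually_ge_atTop 0)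
    obtain ⟨y, -, φ, hφ, hy⟩ := hC.tendsto_subseq (x := fun n ↦ X (t (n + n₀)))
      fun n ↦ hXC _ (hn₀ _ (Nat.le_add_left _ _))
    exact ⟨fun j ↦ φ j + n₀, fun i j hij ↦ Nat.add_lt_add_right (hφ hij) _, y, hy⟩
  refine ⟨?_, ?_, hsub⟩
  · obtain ⟨φ, hφ, y, hy⟩ := hsub (fun n ↦ n) tendsto_natCast_atTop_atTop
    exact ⟨y, fun j ↦ φ j, tendsto_natCast_atTop_atTop.comp hφ.tendsto_atTop, hy⟩
  -- Every limit point stays in the closed set `π ⁻¹' K`, so the closure of the limit set does too.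
  · refine hC.of_isClosed_subset isClosed_closure (closure_minimal ?_ hC.isClosed)
    rintro y ⟨t, ht, hy⟩
    refine hC.isClosed.mem_of_tendsto hy ?_
    filter_upwards [ht.eventually_ge_atTop 0] with n hn using hXC _ hn
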